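/- Let $\mathcal X$ be a countable sample space, $Q$ a probability distribution on $\mathcal X$, $k\ge 1$, $T=(T_{[1]},\dots,T_{[k]}):\mathcal X\to\mathbb R^k$ and $\tilde t\in\mathbb R^k$. Write $Q$ also for the product distribution on $\mathcal X^n$ and $\overline{T}^{(n)}=n^{-1}\sum_{i=1}^n T(X_i)$. Assume that $T$ is of lattice form with span $h=(h_1,\dots,h_k)$: for each $j$, $h_j$ is the largest real number $r$ for which there is a $b\in\mathbb R$ with $T_{[j]}(x)\in\{b+sr: s\in\mathbb Z\}$ for all $x$ with $Q(\{x\})>0$. Let $\Lambda$ be the additive subgroup of $\mathbb R^k$ generated by all differences $T(x)-T(y)$ with $Q(\{x\}),Q(\{y\})>0$, and let $m=[\,h_1\mathbb Z\times\dots\times h_k\mathbb Z:\Lambda\,]$ be its index (so $m=1$ if and only if these differences generate the whole lattice $h_1\mathbb Z\times\dots\times h_k\mathbb Z$; in particular $m=1$ if $k=1$). Assume Condition 1: there is a $\tilde\beta\in\mathbb R^k$ such that $Z(\tilde\beta)=\int e^{-\tilde\beta^{T}T(x)}\,dQ(x)$ is finite and the distribution $\tilde P$ with density $\tilde p(x)=Z(\tilde\beta)^{-1}e^{-\tilde\beta^{T}T(x)}$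 with respect to $Q$ satisfies $E_{\tilde P}[T(X)]=\tilde t$. Assume Condition 2: $T$ has finite second moments under $\tilde P$ and its covariance matrix $\Sigma$ under $\tilde P$ is invertible. Then $\tilde P$ is the maximum entropy distribution, i.e. the unique minimizer of $D(P\|Q)$ over all distributions $P$ on $\mathcal X$ with $E_P[T(X)]=\tilde t$. Write $\tilde P$ also for its product distribution on $\mathcal X^n$. There is a sequence $(c_n)$ with $$\lim_{n\to\infty}c_n=\frac{m\prod_{j=1}^k h_j}{\sqrt{(2\pi)^k\det\Sigma}}$$ (which is $\prod_j h_j/\sqrt{(2\pi)^k\det\Sigma}$ when $m=1$) such that the following holds, where $n$ ranges over the integers $n\ge1$ with $Q(\overline T^{(n)}=\tilde t)>0$. 1. For every sequence of sets $A_n\subset\mathcal X^n$ and all such $n$, $$\tilde P(A_n)\ \ge\ n^{-k/2}\,c_n\,Q(A_n\mid \overline T^{(n)}=\tilde t).\qquad(*)$$ Hence, if $B_n\subset\mathcal X^n$ are sets with $1-\tilde P(B_n)=O(f(n)n^{-k/2})$ for some $f:\mathbb N\to\mathbb R$ with $f(n)=o(1)$, then $Q(B_n\mid\overline T^{(n)}=\tilde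 t)\to1$, and $1-Q(B_n\mid\overline T^{(n)}=\tilde t)=O(f(n))$. 2. If $A_n\subseteq\{(x_1,\dots,x_n): n^{-1}\sum_{i=1}^nT(x_i)=\tilde t\}$ for all $n$, then $(*)$ holds with equality. -/

import Mathlib

open MeasureTheory Filter Topology Asymptotics
open scoped Matrix

namespace MaxEnt

noncomputable section

/-- The `j`-th coordinate of `T` is `Q`-almost surely of the form `b + s * r` with `s` an integer.
(On a countable space this is a condition on the points of positive mass.) -/
def IsLatticeStep {X : Type*} [MeasurableSpace X] {k : ℕ} (Q : Measure X) (T : X → Fin k → ℝ)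
    (j : Fin k) (r : ℝ) : Prop :=
  ∃ b : ℝ, ∀ x : X, Q {x} ≠ 0 → ∃ s : ℤ, T x j = b + (s : ℝ) * r

/-- `T` is a lattice random vector and `h` is its span: `h j` is the largest step of the
`j`-th coordinate. -/
def IsSpan {X : Type*} [MeasurableSpace X] {k : ℕ} (Q : Measure X) (T : X → Fin k → ℝ)
    (h : Fin k → ℝ) : Prop :=
  ∀ j : Fin k, IsGreatest {r : ℝ | IsLatticeStep Q T j r} (h j)

/-- The product lattice `h₁ ℤ × ⋯ × h_k ℤ`. -/
def productLattice {k : ℕ} (h : Fin k → ℝ) : AddSubgroup (Fin k → ℝ) :=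
  AddSubgroup.pi Set.univ fun j => AddSubgroup.zmultiples (h j)

/-- The group generated by the differences `T x - T y` of the values of `T` at points of
positive mass. -/
def differenceLattice {X : Type*} [MeasurableSpace X] {k : ℕ} (Q : Measure X)
    (T : X → Fin k → ℝ) : AddSubgroup (Fin k → ℝ) :=
  AddSubgroup.closure {v | ∃ x y : X, Q {x} ≠ 0 ∧ Q {y} ≠ 0 ∧ v = T x - T y}

/-- The index of the difference lattice in the product lattice; it is `1` exactly when the
differences of `T` generate all of `h₁ ℤ × ⋯ × h_k ℤ` (always so for `k = 1`). -/
def latticeIndex {X : Type*} [MeasurableSpace X] {k : ℕ} (Q : Measure X)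
    (T : X → Fin k → ℝ) (h : Fin k → ℝ) : ℕ :=
  (differenceLattice Q T).relIndex (productLattice h)

/-- The distribution with density `exp (-β ⬝ T x) / Z(β)` with respect to `Q`,
where `Z(β) = ∫ exp (-β ⬝ T x) dQ(x)`. -/
def expDist {X : Type*} [MeasurableSpace X] {k : ℕ} (Q : Measure X) (T : X → Fin k → ℝ)
    (β : Fin k → ℝ) : Measure X :=
  Q.tilted fun x => -(β ⬝ᵥ T x)

/-- The moment constraint `E_P[T] = t` (the expectation exists and equals `t`). -/
def MomentConstraint {X : Type*} [MeasurableSpace X] {k : ℕ} (T : X → Fin k → ℝ)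
    (t : Fin k → ℝ) (P : Measure X) : Prop :=
  ∀ j : Fin k, Integrable (fun x => T x j) P ∧ ∫ x, T x j ∂P = t j

/-- `Z(β)` is finite and the exponential distribution with parameter `β` satisfies the
constraint. -/
def Condition1 {X : Type*} [MeasurableSpace X] {k : ℕ} (Q : Measure X) (T : X → Fin k → ℝ)
    (t β : Fin k → ℝ) : Prop :=
  Integrable (fun x => Real.exp (-(β ⬝ᵥ T x))) Q ∧ MomentConstraint T t (expDist Q T β)

/-- The covariance matrix of `T` under `P`. -/
def covMatrix {X : Type*} [MeasurableSpace X] {k : ℕ} (T : X → Fin k → ℝ) (P : Measure X) :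
    Matrix (Fin k) (Fin k) ℝ :=
  Matrix.of fun i j => (∫ x, T x i * T x j ∂P) - (∫ x, T x i ∂P) * ∫ x, T x j ∂P

/-- The covariance matrix of `T` under `P` exists (finite second moments) and is invertible. -/
def Condition2 {X : Type*} [MeasurableSpace X] {k : ℕ} (T : X → Fin k → ℝ) (P : Measure X) :
    Prop :=
  (∀ i j : Fin k, Integrable (fun x => T x i * T x j) P) ∧ IsUnit (covMatrix T P)

/-- `P` is the unique minimizer of `D(P ‖ Q)` (that is, the unique maximizer of the `Q`-entropy)
among the probability distributions satisfying the moment constraint. -/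
def IsMaxEnt {X : Type*} [MeasurableSpace X] {k : ℕ} (Q : Measure X) (T : X → Fin k → ℝ)
    (t : Fin k → ℝ) (P : Measure X) : Prop :=
  (IsProbabilityMeasure P ∧ MomentConstraint T t P) ∧
    ∀ P' : Measure X, IsProbabilityMeasure P' → MomentConstraint T t P' → P' ≠ P →
      InformationTheory.klDiv P Q < InformationTheory.klDiv P' Q

/-- The `n`-fold product distribution on `X ^ n`. -/
def prodDist {X : Type*} [MeasurableSpace X] (P : Measure X) (n : ℕ) : Measure (Fin n → X) :=
  Measure.pi fun _ => P

/-- The samples of size `n` whose average of `T` equals `t`. -/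
def constraintSet {X : Type*} {k : ℕ} (T : X → Fin k → ℝ) (t : Fin k → ℝ) (n : ℕ) :
    Set (Fin n → X) :=
  {x | (n : ℝ)⁻¹ • ∑ i, T (x i) = t}

/-- The sample sizes `n ≥ 1` at which the empirical constraint has positive probability. -/
def feasible {X : Type*} [MeasurableSpace X] {k : ℕ} (Q : Measure X) (T : X → Fin k → ℝ)
    (t : Fin k → ℝ) : Set ℕ :=
  {n | 0 < n ∧ 0 < prodDist Q n (constraintSet T t n)}

/-- The conditional probability `Q(A | average of T over the sample = t)`. -/
def condProb {X : Type*} [MeasurableSpace X] {k : ℕ} (Q : Measure X) (T : X → Fin k → ℝ)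
    (t : Fin k → ℝ) (n : ℕ) (A : Set (Fin n → X)) : ℝ :=
  (ProbabilityTheory.cond (prodDist Q n) (constraintSet T t n)).real A

end

end MaxEnt

namespace MaxEnt

open Real

/-! On samples whose average of `T` is `t`, the density of the tilted product measure with respect
to that of `Q` is `exp (-n β ⬝ t) / Z ^ n`, a constant. Both measures therefore have the same
conditional law given the constraint set `C_n`, and `P̃(C_n ∩ A) = P̃(C_n) * Q(A | C_n)` exactly
(`prodDist_expDist_inter_constraintSet`). Dropping the intersection gives item 1, and `A ⊆ C_n`
gives item 2. What remains is `n ^ (k/2) * P̃(C_n) → m ∏ h_j / √((2π)^k det Σ)`.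

This is a local limit theorem. Invertibility of `Σ` makes the difference lattice `Λ` full rank, so a
matrix `M` maps it onto `ℤ ^ k`, and `|det M|⁻¹` is the covolume `m ∏ h_j` of `Λ`. For `Y = M (T -
t)`, Fourier inversion writes `P̃(∑ Y = 0)` as an integral of the `n`-th power of the characteristic
function over `[-π, π] ^ k`. After rescaling by `√n`, the integrand converges pointwise to a
Gaussian by the central limit theorem. It is dominated because `|φ(θ)| ≤ exp (-c |θ|²)` on the whole
cube (`exists_norm_vecCharFun_le`).

Maximum entropy is separate: `log (dP̃/dQ)` is affine in `T`, so its mean is fixed by the moment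
constraint and `D(P'‖Q) = D(P'‖P̃) + D(P̃‖Q)` when `D(P'‖Q)` is finite. -/

/-- The characteristic function of the random vector `Y` under `P`. -/
noncomputable def vecCharFun {X : Type*} [MeasurableSpace X] {k : ℕ} (P : Measure X)
    (Y : X → Fin k → ℝ) (θ : Fin k → ℝ) : ℂ :=
  ∫ x, Complex.exp ((θ ⬝ᵥ Y x : ℝ) * Complex.I) ∂P

/-! ### Characteristic functions: decay on the cube and the central limit -/

section CharFun

variable {X : Type*} [MeasurableSpace X] [DiscreteMeasurableSpace X] {k : ℕ}
  {P : Measure X} [IsProbabilityMeasure P]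

lemma integrable_cexp_mul_I (g : X → ℝ) :
    Integrable (fun x => Complex.exp ((g x : ℝ) * Complex.I)) P := by
  refine Integrable.of_bound (Measurable.of_discrete).aestronglyMeasurable 1 ?_
  exact ae_of_all _ fun x => by rw [Complex.norm_exp_ofReal_mul_I]

omit [DiscreteMeasurableSpace X] in
lemma norm_vecCharFun_le_one (Y : X → Fin k → ℝ) (θ : Fin k → ℝ) : ‖vecCharFun P Y θ‖ ≤ 1 := by
  refine (norm_integral_le_integral_norm _).trans ?_
  simp [Complex.norm_exp_ofReal_mul_I]

/-- Rotating by the argument of the characteristic function makes it real. Then `1 - ‖φ(θ)‖` is the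
integral of the nonnegative function `1 - cos`, which can be bounded below atom by atom. -/
lemma exists_norm_vecCharFun_eq (Y : X → Fin k → ℝ) (θ : Fin k → ℝ) :
    ∃ α : ℝ, ‖vecCharFun P Y θ‖ = ∫ x, cos (θ ⬝ᵥ Y x - α) ∂P := by
  refine ⟨(vecCharFun P Y θ).arg, ?_⟩
  set α := (vecCharFun P Y θ).arg
  have h1 : (‖vecCharFun P Y θ‖ : ℂ)
      = vecCharFun P Y θ * Complex.exp ((-α : ℝ) * Complex.I) := by
    conv_rhs => rw [← Complex.norm_mul_exp_arg_mul_I (vecCharFun P Y θ)]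
    rw [mul_assoc, ← Complex.exp_add]
    simp [α]
  have h2 : vecCharFun P Y θ * Complex.exp ((-α : ℝ) * Complex.I)
      = ∫ x, Complex.exp ((θ ⬝ᵥ Y x - α : ℝ) * Complex.I) ∂P := by
    rw [vecCharFun, ← integral_mul_const]
    refine integral_congr_ae (ae_of_all _ fun x => ?_)
    simp only
    rw [← Complex.exp_add]
    congr 1
    push_cast
    ring
  rw [h2] at h1
  have h3 := congrArg Complex.re h1
  rw [Complex.ofReal_re] at h3
  rw [h3, ← RCLike.re_eq_complex_re, ← integral_re (integrable_cexp_mul_I _)]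
  refine integral_congr_ae (ae_of_all _ fun x => ?_)
  exact Complex.exp_ofReal_mul_I_re _

lemma sin_half_add_sq_le (a b : ℝ) :
    sin ((a + b) / 2) ^ 2 ≤ 2 * sin (a / 2) ^ 2 + 2 * sin (b / 2) ^ 2 := by
  have e : (a + b) / 2 = a / 2 + b / 2 := by ring
  have h1 : |sin ((a + b) / 2)| ≤ |sin (a / 2)| + |sin (b / 2)| := by
    rw [e, sin_add]
    refine (abs_add_le _ _).trans ?_
    rw [abs_mul, abs_mul]
    have := abs_cos_le_one (a / 2)
    have := abs_cos_le_one (b / 2)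
    nlinarith [abs_nonneg (sin (a / 2)), abs_nonneg (sin (b / 2))]
  have h2 := pow_le_pow_left₀ (abs_nonneg _) h1 2
  rw [sq_abs] at h2
  nlinarith [sq_nonneg (|sin (a / 2)| - |sin (b / 2)|), sq_abs (sin (a / 2)),
    sq_abs (sin (b / 2))]

/-- The defect `1 - ‖φ(θ)‖` is the mean of `2 sin² ((θ ⬝ Y - α) / 2)`, so it controls this term at
every atom. Comparing two atoms eliminates the unknown phase `α`, and `sin_half_add_sq_le` carries
the bound from differences to the group they generate. The constant depends on `v` but not on `θ`.
-/
lemma exists_sin_sq_le (Y : X → Fin k → ℝ) {v : Fin k → ℝ} (hv : v ∈ differenceLattice P Y) :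
    ∃ C : ℝ, ∀ θ : Fin k → ℝ, sin ((θ ⬝ᵥ v) / 2) ^ 2 ≤ C * (1 - ‖vecCharFun P Y θ‖) := by
  induction hv using AddSubgroup.closure_induction with
  | mem v hv =>
    obtain ⟨x, y, hx, hy, rfl⟩ := hv
    have key : ∀ z : X, P {z} ≠ 0 → ∀ (θ : Fin k → ℝ) (α : ℝ),
        ‖vecCharFun P Y θ‖ = ∫ x, cos (θ ⬝ᵥ Y x - α) ∂P →
        sin ((θ ⬝ᵥ Y z - α) / 2) ^ 2 ≤ (2 * P.real {z})⁻¹ * (1 - ‖vecCharFun P Y θ‖) := by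
      intro z hz θ α hα
      have hp : 0 < P.real {z} := by
        rw [measureReal_def]
        exact ENNReal.toReal_pos hz (measure_ne_top _ _)
      have hint : Integrable (fun x => cos (θ ⬝ᵥ Y x - α)) P :=
        Integrable.of_bound (Measurable.of_discrete).aestronglyMeasurable 1
          (ae_of_all _ fun x => by rw [Real.norm_eq_abs]; exact abs_cos_le_one _)
      have h1 : 1 - ‖vecCharFun P Y θ‖ = ∫ x, (1 - cos (θ ⬝ᵥ Y x - α)) ∂P := by
        rw [integral_sub (integrable_const _) hint, hα]
        simp
      have h2 : ∫ x in {z}, (1 - cos (θ ⬝ᵥ Y x - α)) ∂P ≤ ∫ x, (1 - cos (θ ⬝ᵥ Y x - α)) ∂P :=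
        setIntegral_le_integral ((integrable_const _).sub hint)
          (ae_of_all _ fun x => sub_nonneg.2 (cos_le_one _))
      rw [integral_singleton, ← h1, smul_eq_mul] at h2
      have h3 : 1 - cos (θ ⬝ᵥ Y z - α) = 2 * sin ((θ ⬝ᵥ Y z - α) / 2) ^ 2 := by
        have := cos_two_mul ((θ ⬝ᵥ Y z - α) / 2)
        rw [show 2 * ((θ ⬝ᵥ Y z - α) / 2) = θ ⬝ᵥ Y z - α by ring] at this
        rw [this, cos_sq']
        ring
      rw [h3] at h2
      rw [inv_mul_eq_div, le_div_iff₀ (by positivity)]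
      linarith
    refine ⟨2 * (2 * P.real {x})⁻¹ + 2 * (2 * P.real {y})⁻¹, fun θ => ?_⟩
    obtain ⟨α, hα⟩ := exists_norm_vecCharFun_eq (P := P) Y θ
    have h1 := key x hx θ α hα
    have h2 := key y hy θ α hα
    have h3 := sin_half_add_sq_le (θ ⬝ᵥ Y x - α) (-(θ ⬝ᵥ Y y - α))
    rw [neg_div, sin_neg, neg_sq] at h3
    rw [dotProduct_sub]
    rw [show θ ⬝ᵥ Y x - α + -(θ ⬝ᵥ Y y - α) = θ ⬝ᵥ Y x - θ ⬝ᵥ Y y by ring] at h3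
    linarith
  | zero => exact ⟨0, fun θ => by simp⟩
  | add v w _ _ ihv ihw =>
    obtain ⟨C, hC⟩ := ihv
    obtain ⟨D, hD⟩ := ihw
    refine ⟨2 * C + 2 * D, fun θ => ?_⟩
    rw [dotProduct_add]
    linarith [sin_half_add_sq_le (θ ⬝ᵥ v) (θ ⬝ᵥ w), hC θ, hD θ]
  | neg v _ ih =>
    obtain ⟨C, hC⟩ := ih
    refine ⟨C, fun θ => ?_⟩
    rw [dotProduct_neg, neg_div, sin_neg, neg_sq]
    exact hC θ

lemma sq_le_pi_sq_mul_sin_sq {x : ℝ} (hx : |x| ≤ π) : x ^ 2 ≤ π ^ 2 * sin (x / 2) ^ 2 := by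
  have h := mul_abs_le_abs_sin (x := x / 2) (by rw [abs_div, abs_two]; linarith)
  rw [abs_div, abs_two] at h
  have h' : |x| ≤ π * |sin (x / 2)| := by
    have hpi := pi_pos
    have h2 : π * (2 / π * (|x| / 2)) = |x| := by field_simp
    calc |x| = π * (2 / π * (|x| / 2)) := h2.symm
      _ ≤ _ := by gcongr
  calc x ^ 2 = |x| ^ 2 := (sq_abs x).symm
    _ ≤ (π * |sin (x / 2)|) ^ 2 := by gcongr
    _ = _ := by rw [mul_pow, sq_abs]

/-- With `v = e_j`, `sin (θ j / 2)` vanishes on the cube only at `θ j = 0` and is comparable to `θ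
j`. One bound thus serves both near the origin and away from it. -/
lemma exists_norm_vecCharFun_le (Y : X → Fin k → ℝ)
    (hgen : ∀ j, Pi.single j 1 ∈ differenceLattice P Y) :
    ∃ c : ℝ, 0 < c ∧ ∀ θ : Fin k → ℝ, (∀ j, |θ j| ≤ π) →
      ‖vecCharFun P Y θ‖ ≤ exp (-(c * ∑ j, θ j ^ 2)) := by
  choose C hC using fun j => exists_sin_sq_le Y (hgen j)
  have hS : 0 ≤ ∑ j, |C j| := Finset.sum_nonneg fun j _ => abs_nonneg _
  -- The `+ 1` keeps the constant positive even if the sum vanishes.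
  refine ⟨(π ^ 2 * (∑ j, |C j|) + 1)⁻¹, by positivity, fun θ hθ => ?_⟩
  set r := ‖vecCharFun P Y θ‖
  have hr : 0 ≤ 1 - r := sub_nonneg.2 (norm_vecCharFun_le_one Y θ)
  have h1 : ∑ j, θ j ^ 2 ≤ (π ^ 2 * (∑ j, |C j|) + 1) * (1 - r) := by
    calc ∑ j, θ j ^ 2 ≤ ∑ j, π ^ 2 * (|C j| * (1 - r)) := by
          refine Finset.sum_le_sum fun j _ => (sq_le_pi_sq_mul_sin_sq (hθ j)).trans ?_
          have h := hC j θ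
          rw [dotProduct_single_one] at h
          gcongr
          exact h.trans (mul_le_mul_of_nonneg_right (le_abs_self _) hr)
      _ = π ^ 2 * (∑ j, |C j|) * (1 - r) := by
          rw [← Finset.mul_sum, ← Finset.sum_mul, mul_assoc]
      _ ≤ _ := by nlinarith
  have h2 : (π ^ 2 * (∑ j, |C j|) + 1)⁻¹ * ∑ j, θ j ^ 2 ≤ 1 - r := by
    rw [inv_mul_eq_div, div_le_iff₀ (by positivity)]
    linarith
  have h3 := add_one_le_exp (-((π ^ 2 * (∑ j, |C j|) + 1)⁻¹ * ∑ j, θ j ^ 2))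
  linarith

lemma continuous_vecCharFun (Y : X → Fin k → ℝ) : Continuous (vecCharFun P Y) := by
  refine continuous_of_dominated (bound := fun _ => 1)
    (fun θ => (Measurable.of_discrete).aestronglyMeasurable)
    (fun θ => ae_of_all _ fun x => by rw [Complex.norm_exp_ofReal_mul_I])
    (integrable_const _) (ae_of_all _ fun x => ?_)
  simp only [dotProduct]
  fun_prop

/-- Along a fixed direction `u` this is the scalar central limit theorem for `u ⬝ Y`, normalised to
unit variance and evaluated at `√s` to undo the normalisation. Zero variance cannot be normalised,
but then `u ⬝ Y = 0` almost surely. -/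
lemma tendsto_vecCharFun_inv_sqrt_smul_pow (Y : X → Fin k → ℝ) (u : Fin k → ℝ)
    (h2 : Integrable (fun x => (u ⬝ᵥ Y x) ^ 2) P) (h0 : ∫ x, u ⬝ᵥ Y x ∂P = 0) :
    Tendsto (fun n : ℕ => vecCharFun P Y ((√n)⁻¹ • u) ^ n) atTop
      (𝓝 ((exp (-(∫ x, (u ⬝ᵥ Y x) ^ 2 ∂P) / 2) : ℝ) : ℂ)) := by
  set s := ∫ x, (u ⬝ᵥ Y x) ^ 2 ∂P with hs
  have hs0 : 0 ≤ s := integral_nonneg fun x => sq_nonneg _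
  rcases hs0.eq_or_lt with h | h
  · have hW : (fun x => u ⬝ᵥ Y x) =ᵐ[P] 0 := by
      have := (integral_eq_zero_iff_of_nonneg (fun x => sq_nonneg _) h2).1 h.symm
      filter_upwards [this] with x hx
      simpa using hx
    have h1 : ∀ n : ℕ, vecCharFun P Y ((√n)⁻¹ • u) = 1 := by
      intro n
      have : vecCharFun P Y ((√n)⁻¹ • u) = ∫ x, (1 : ℂ) ∂P := by
        refine integral_congr_ae ?_
        filter_upwards [hW] with x hx
        simp only [Pi.zero_apply] at hx
        simp [smul_dotProduct, hx]
      rw [this]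
      simp
    simp [h1, ← h]
  · have hsq : √s ≠ 0 := (sqrt_pos.2 h).ne'
    have := ProbabilityTheory.tendsto_charFun_inv_sqrt_mul_pow (P := P)
      (X := fun x => (u ⬝ᵥ Y x) / √s) (Measurable.of_discrete).aemeasurable
      (by rw [integral_div, h0, zero_div])
      (by
        simp only [Pi.pow_apply, div_pow, sq_sqrt hs0]
        rw [integral_div, ← hs, div_self h.ne']) (√s)
    have e : ((exp (-s / 2) : ℝ) : ℂ) = Complex.exp (-(√s : ℂ) ^ 2 / 2) := by
      rw [← Complex.ofReal_pow, sq_sqrt hs0]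
      push_cast
      rfl
    rw [e]
    refine this.congr fun n => ?_
    congr 1
    rw [charFun_apply_real, integral_map (Measurable.of_discrete).aemeasurable
      (by fun_prop), vecCharFun]
    refine integral_congr_ae (ae_of_all _ fun x => ?_)
    simp only [smul_dotProduct, smul_eq_mul]
    congr 2
    have : (√s : ℂ) ≠ 0 := by exact_mod_cast hsq
    push_cast
    field_simp

end CharFun

end MaxEnt

namespace MaxEnt

open Real

/-! ### The multivariate Gaussian integral -/

section GaussianIntegral

open scoped MatrixOrder Matrix.Norms.L2Operator

lemma integral_exp_neg_sum_sq_div_two (k : ℕ) :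
    ∫ u : Fin k → ℝ, exp (-(∑ j, u j ^ 2) / 2) = √((2 * π) ^ k) := by
  have h : ∀ u : Fin k → ℝ, exp (-(∑ j, u j ^ 2) / 2) = ∏ j, exp (-(1 / 2) * u j ^ 2) := by
    intro u
    rw [← exp_sum, ← Finset.mul_sum]
    congr 1
    ring
  simp_rw [h]
  rw [integral_fintype_prod_volume_eq_pow (fun x : ℝ => exp (-(1 / 2) * x ^ 2)), integral_gaussian,
    Fintype.card_fin, show π / (1 / 2) = 2 * π by ring, sqrt_eq_rpow, sqrt_eq_rpow, ← rpow_natCast,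
    ← rpow_natCast, ← rpow_mul (by positivity), ← rpow_mul (by positivity), mul_comm (1 / 2 : ℝ)]

lemma integral_comp_mulVec {k : ℕ} (M : Matrix (Fin k) (Fin k) ℝ) (hM : M.det ≠ 0)
    (g : (Fin k → ℝ) → ℝ) (hg : Continuous g) :
    ∫ u, g (M *ᵥ u) = |M.det|⁻¹ * ∫ u, g u := by
  have h := Real.map_matrix_volume_pi_eq_smul_volume_pi hM
  have h1 : ∫ u, g u ∂(Measure.map (Matrix.toLin' M) volume) = ∫ u, g (M *ᵥ u) := by
    rw [integral_map ((Matrix.toLin' M).continuous_of_finiteDimensional.aemeasurable)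
      hg.aestronglyMeasurable]
    simp
  rw [← h1, h, integral_smul_measure, ENNReal.toReal_ofReal (abs_nonneg _), smul_eq_mul, abs_inv]

/-- The multivariate Gaussian integral. -/
lemma integral_exp_neg_quadratic {k : ℕ} (V : Matrix (Fin k) (Fin k) ℝ) (hV : V.PosDef) :
    ∫ u : Fin k → ℝ, exp (-(u ⬝ᵥ V *ᵥ u) / 2) = √((2 * π) ^ k) / √V.det := by
  -- Factoring `V = Mᵀ M` and substituting `w = M u` reduces to the standard Gaussian.
  obtain ⟨M, rfl⟩ := CStarAlgebra.nonneg_iff_eq_star_mul_self.mp hV.posSemidef.nonneg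
  have hdet : (star M * M).det = M.det ^ 2 := by
    rw [Matrix.det_mul, Matrix.star_eq_conjTranspose, Matrix.det_conjTranspose, sq]
    simp
  have hM : M.det ≠ 0 := by
    have := hV.det_pos
    rw [hdet] at this
    exact fun h => by simp [h] at this
  have h : ∀ u : Fin k → ℝ, u ⬝ᵥ (star M * M) *ᵥ u = ∑ j, (M *ᵥ u) j ^ 2 := by
    intro u
    rw [← Matrix.mulVec_mulVec, Matrix.star_eq_conjTranspose, Matrix.dotProduct_mulVec,
      Matrix.conjTranspose_eq_transpose_of_trivial, Matrix.vecMul_transpose, dotProduct]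
    simp only [sq]
  simp_rw [h]
  rw [integral_comp_mulVec M hM (fun w => exp (-(∑ j, w j ^ 2) / 2)) (by fun_prop),
    integral_exp_neg_sum_sq_div_two, hdet, sqrt_sq_eq_abs]
  field_simp

end GaussianIntegral

/-! ### Fourier inversion on the integer lattice -/

section Inversion

variable {X : Type*} [Countable X] [MeasurableSpace X] [DiscreteMeasurableSpace X] {k : ℕ}
  {P : Measure X} [IsProbabilityMeasure P]

/-- The cube `[-π, π] ^ k`. -/
def piCube (k : ℕ) : Set (Fin k → ℝ) := Set.univ.pi fun _ => Set.Icc (-π) π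

omit [Countable X] [DiscreteMeasurableSpace X] in
lemma vecCharFun_pow (Y : X → Fin k → ℝ) (θ : Fin k → ℝ) (n : ℕ) :
    vecCharFun P Y θ ^ n
      = ∫ x, Complex.exp ((θ ⬝ᵥ ∑ i, Y (x i) : ℝ) * Complex.I) ∂(prodDist P n) := by
  have h := integral_fintype_prod_eq_pow (ι := Fin n)
    (μ := P) (fun x : X => Complex.exp ((θ ⬝ᵥ Y x : ℝ) * Complex.I))
  rw [Fintype.card_fin] at h
  rw [vecCharFun, ← h, prodDist]
  refine integral_congr_ae (ae_of_all _ fun x => ?_)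
  simp only
  rw [← Complex.exp_sum, dotProduct_sum, Complex.ofReal_sum, Finset.sum_mul]

lemma integral_cexp_int_mul (m : ℤ) :
    ∫ t in Set.Icc (-π) π, Complex.exp ((t * m : ℝ) * Complex.I)
      = if m = 0 then (2 * π : ℂ) else 0 := by
  rw [integral_Icc_eq_integral_Ioc, ← intervalIntegral.integral_of_le (by linarith [pi_pos])]
  split_ifs with h
  · subst h
    simp
    ring
  · have hc : (m * Complex.I : ℂ) ≠ 0 := by simp [h]
    have h1 : ∀ t : ℝ, Complex.exp ((t * m : ℝ) * Complex.I)
        = Complex.exp ((m * Complex.I) * t) := by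
      intro t
      push_cast
      ring_nf
    simp_rw [h1]
    rw [integral_exp_mul_complex hc]
    have h2 : Complex.exp (m * Complex.I * (π : ℝ))
        = Complex.exp (m * Complex.I * ((-π : ℝ) : ℂ)) := by
      rw [Complex.exp_eq_exp_iff_exists_int]
      exact ⟨m, by push_cast; ring⟩
    rw [h2, sub_self, zero_div]

lemma integral_piCube_cexp (m : Fin k → ℤ) :
    ∫ θ in piCube k, Complex.exp ((θ ⬝ᵥ (fun j => (m j : ℝ)) : ℝ) * Complex.I)
      = if m = 0 then (2 * π : ℂ) ^ k else 0 := by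
  have h : ∀ θ : Fin k → ℝ, Complex.exp ((θ ⬝ᵥ (fun j => (m j : ℝ)) : ℝ) * Complex.I)
      = ∏ j, Complex.exp ((θ j * m j : ℝ) * Complex.I) := by
    intro θ
    rw [← Complex.exp_sum, dotProduct, Complex.ofReal_sum, Finset.sum_mul]
  simp_rw [h]
  rw [piCube, volume_pi, Measure.restrict_pi_pi]
  rw [integral_fintype_prod_eq_prod (fun j (t : ℝ) => Complex.exp ((t * m j : ℝ) * Complex.I))]
  simp_rw [integral_cexp_int_mul]
  split_ifs with h0
  · simp [h0]
  · obtain ⟨j, hj⟩ := Function.ne_iff.1 h0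
    exact Finset.prod_eq_zero (Finset.mem_univ j) (by simpa using hj)

lemma isCompact_piCube (k : ℕ) : IsCompact (piCube k) :=
  isCompact_univ_pi fun _ => isCompact_Icc

/-- Fourier inversion for a sum of independent vectors which lies in `ℤ ^ k` almost surely. -/
lemma setIntegral_vecCharFun_pow (Y : X → Fin k → ℝ) (n : ℕ)
    (hint : ∀ᵐ x ∂(prodDist P n), ∀ j, ∃ m : ℤ, (∑ i, Y (x i)) j = m) :
    ∫ θ in piCube k, vecCharFun P Y θ ^ n
      = (2 * π : ℂ) ^ k * ((prodDist P n).real {x | ∑ i, Y (x i) = 0} : ℝ) := by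
  have : IsProbabilityMeasure (prodDist P n) := by unfold prodDist; infer_instance
  have : IsFiniteMeasure (volume.restrict (piCube k)) :=
    isFiniteMeasure_restrict.2 (isCompact_piCube k).measure_lt_top.ne
  simp_rw [vecCharFun_pow]
  rw [integral_integral_swap]
  · have h : ∀ᵐ x ∂(prodDist P n),
        ∫ θ in piCube k, Complex.exp ((θ ⬝ᵥ ∑ i, Y (x i) : ℝ) * Complex.I)
        = Set.indicator {x : Fin n → X | ∑ i, Y (x i) = 0} (fun _ => (2 * π : ℂ) ^ k) x := by
      filter_upwards [hint] with x hx
      choose m hm using hx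
      have hm' : ∑ i, Y (x i) = fun j => (m j : ℝ) := funext hm
      have e : x ∈ {x : Fin n → X | ∑ i, Y (x i) = 0} ↔ m = 0 := by
        rw [Set.mem_ofPred_eq, hm']
        simp [funext_iff]
      simp_rw [hm']
      rw [integral_piCube_cexp, Set.indicator_apply]
      simp only [e]
    rw [integral_congr_ae h, integral_indicator_const _ (MeasurableSet.of_discrete)]
    rw [Complex.real_smul, mul_comm]
  · refine Integrable.of_bound ?_ 1
      (ae_of_all _ fun p => by
        simp only [Function.uncurry]; rw [Complex.norm_exp_ofReal_mul_I])
    refine Measurable.aestronglyMeasurable ?_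
    -- The sample space is countable, so joint measurability follows from continuity in `θ` for each
    -- sample.
    refine measurable_from_prod_countable_left fun x => ?_
    simp only [Function.uncurry, dotProduct]
    fun_prop

end Inversion

end MaxEnt

namespace MaxEnt

open Real

/-! ### The local limit theorem -/

section LocalLimit

variable {X : Type*} [Countable X] [MeasurableSpace X] [DiscreteMeasurableSpace X] {k : ℕ}
  {P : Measure X} [IsProbabilityMeasure P]

omit [Countable X] [DiscreteMeasurableSpace X] [IsProbabilityMeasure P] in
lemma integral_dotProduct (Y : X → Fin k → ℝ) (h1 : ∀ i, Integrable (fun x => Y x i) P)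
    (u : Fin k → ℝ) : ∫ x, u ⬝ᵥ Y x ∂P = u ⬝ᵥ fun i => ∫ x, Y x i ∂P := by
  simp only [dotProduct]
  rw [integral_finsetSum _ fun i _ => (h1 i).const_mul _]
  simp_rw [integral_const_mul]

omit [Countable X] [MeasurableSpace X] [DiscreteMeasurableSpace X] in
lemma dotProduct_sq_eq_sum (Y : X → Fin k → ℝ) (u : Fin k → ℝ) (x : X) :
    (u ⬝ᵥ Y x) ^ 2 = ∑ i, ∑ j, u i * u j * (Y x i * Y x j) := by
  rw [sq, dotProduct, Finset.sum_mul_sum]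
  refine Finset.sum_congr rfl fun i _ => Finset.sum_congr rfl fun j _ => ?_
  ring

omit [Countable X] [DiscreteMeasurableSpace X] [IsProbabilityMeasure P] in
lemma integrable_dotProduct_sq (Y : X → Fin k → ℝ)
    (h2 : ∀ i j, Integrable (fun x => Y x i * Y x j) P) (u : Fin k → ℝ) :
    Integrable (fun x => (u ⬝ᵥ Y x) ^ 2) P := by
  simp_rw [dotProduct_sq_eq_sum]
  exact integrable_finsetSum _ fun i _ => integrable_finsetSum _ fun j _ => (h2 i j).const_mul _

omit [Countable X] [DiscreteMeasurableSpace X] [IsProbabilityMeasure P] in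
lemma integral_dotProduct_sq (Y : X → Fin k → ℝ)
    (h2 : ∀ i j, Integrable (fun x => Y x i * Y x j) P) (h0 : ∀ i, ∫ x, Y x i ∂P = 0)
    (u : Fin k → ℝ) : ∫ x, (u ⬝ᵥ Y x) ^ 2 ∂P = u ⬝ᵥ covMatrix Y P *ᵥ u := by
  simp_rw [dotProduct_sq_eq_sum]
  rw [integral_finsetSum _ fun i _ => integrable_finsetSum _ fun j _ => (h2 i j).const_mul _]
  simp only [dotProduct, Matrix.mulVec, covMatrix, Matrix.of_apply, h0, mul_zero, sub_zero]
  refine Finset.sum_congr rfl fun i _ => ?_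
  rw [integral_finsetSum _ fun j _ => (h2 i j).const_mul _, Finset.mul_sum]
  refine Finset.sum_congr rfl fun j _ => ?_
  rw [integral_const_mul]
  ring

/-- The rescaled integrand of Fourier inversion. -/
noncomputable def rescaledCharFun (P : Measure X) (Y : X → Fin k → ℝ) (n : ℕ) (u : Fin k → ℝ) : ℂ :=
  (piCube k).indicator (fun θ => vecCharFun P Y θ ^ n) ((√n)⁻¹ • u)

lemma piCube_mem_nhds_zero (k : ℕ) : piCube k ∈ 𝓝 (0 : Fin k → ℝ) :=
  set_pi_mem_nhds Set.finite_univ fun _ _ =>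
    Icc_mem_nhds (by simpa using pi_pos) (by simpa using pi_pos)

omit [Countable X] in
lemma tendsto_rescaledCharFun (Y : X → Fin k → ℝ) (u : Fin k → ℝ)
    (h2 : ∀ i j, Integrable (fun x => Y x i * Y x j) P)
    (h1 : ∀ i, Integrable (fun x => Y x i) P) (h0 : ∀ i, ∫ x, Y x i ∂P = 0) :
    Tendsto (fun n => rescaledCharFun P Y n u) atTop
      (𝓝 ((exp (-(u ⬝ᵥ covMatrix Y P *ᵥ u) / 2) : ℝ) : ℂ)) := by
  have h := tendsto_vecCharFun_inv_sqrt_smul_pow (P := P) Y u (integrable_dotProduct_sq Y h2 u)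
    (by rw [integral_dotProduct Y h1]; simp [h0, dotProduct])
  rw [integral_dotProduct_sq Y h2 h0] at h
  refine h.congr' ?_
  have hlim : Tendsto (fun n : ℕ => (√n)⁻¹ • u) atTop (𝓝 0) := by
    rw [← zero_smul ℝ u]
    exact (tendsto_inv_atTop_zero.comp (tendsto_sqrt_atTop.comp
      tendsto_natCast_atTop_atTop)).smul_const u
  filter_upwards [hlim (piCube_mem_nhds_zero k)] with n hn
  exact (Set.indicator_of_mem hn _).symm

-- The `n`-th power cancels the `1/√n` scaling exactly, so the bound is independent of `n` and can
-- serve as a dominating function.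
omit [Countable X] [DiscreteMeasurableSpace X] [IsProbabilityMeasure P] in
lemma norm_rescaledCharFun_le (Y : X → Fin k → ℝ) {c : ℝ}
    (hc : ∀ θ : Fin k → ℝ, (∀ j, |θ j| ≤ π) → ‖vecCharFun P Y θ‖ ≤ exp (-(c * ∑ j, θ j ^ 2)))
    {n : ℕ} (hn : 0 < n) (u : Fin k → ℝ) :
    ‖rescaledCharFun P Y n u‖ ≤ exp (-(c * ∑ j, u j ^ 2)) := by
  unfold rescaledCharFun
  by_cases h : (√n)⁻¹ • u ∈ piCube k
  · rw [Set.indicator_of_mem h, norm_pow]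
    refine (pow_le_pow_left₀ (norm_nonneg _) (hc _ fun j => ?_) n).trans_eq ?_
    · exact abs_le.2 (h j (Set.mem_univ j))
    · rw [← exp_nat_mul]
      congr 1
      have hn' : (n : ℝ) ≠ 0 := by positivity
      simp only [Pi.smul_apply, smul_eq_mul, mul_pow, inv_pow, sq_sqrt (Nat.cast_nonneg n)]
      rw [← Finset.mul_sum]
      field_simp
  · rw [Set.indicator_of_notMem h, norm_zero]
    positivity

lemma integrable_exp_neg_mul_sum_sq {c : ℝ} (hc : 0 < c) :
    Integrable (fun u : Fin k → ℝ => exp (-(c * ∑ j, u j ^ 2))) := by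
  have h : ∀ u : Fin k → ℝ, exp (-(c * ∑ j, u j ^ 2)) = ∏ j, exp (-c * u j ^ 2) := by
    intro u
    rw [← exp_sum, ← Finset.mul_sum, neg_mul]
  simp_rw [h]
  exact Integrable.fintype_prod fun _ => integrable_exp_neg_mul_sq hc

omit [Countable X] in
lemma tendsto_integral_rescaledCharFun (Y : X → Fin k → ℝ)
    (h2 : ∀ i j, Integrable (fun x => Y x i * Y x j) P)
    (h1 : ∀ i, Integrable (fun x => Y x i) P) (h0 : ∀ i, ∫ x, Y x i ∂P = 0)
    (hV : (covMatrix Y P).PosDef) (hgen : ∀ j, Pi.single j 1 ∈ differenceLattice P Y) :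
    Tendsto (fun n => ∫ u, rescaledCharFun P Y n u) atTop
      (𝓝 ((√((2 * π) ^ k) / √(covMatrix Y P).det : ℝ) : ℂ)) := by
  obtain ⟨c, hc, hb⟩ := exists_norm_vecCharFun_le (P := P) Y hgen
  rw [← integral_exp_neg_quadratic _ hV, ← integral_complex_ofReal]
  refine tendsto_integral_filter_of_dominated_convergence _ (Eventually.of_forall fun n => ?_)
    ?_ (integrable_exp_neg_mul_sum_sq hc)
    (ae_of_all _ fun u => tendsto_rescaledCharFun Y u h2 h1 h0)
  · refine Measurable.aestronglyMeasurable ?_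
    exact (((continuous_vecCharFun Y).pow n).measurable.indicator
      (isCompact_piCube k).measurableSet).comp (measurable_const_smul _)
  · filter_upwards [eventually_gt_atTop 0] with n hn
    exact ae_of_all _ fun u => norm_rescaledCharFun_le Y hb hn u

/-- The substitution `u = √n θ` contributes the Jacobian `n ^ (k/2)`. -/
lemma integral_rescaledCharFun (Y : X → Fin k → ℝ) (n : ℕ)
    (hint : ∀ᵐ x ∂(prodDist P n), ∀ j, ∃ m : ℤ, (∑ i, Y (x i)) j = m) :
    ∫ u, rescaledCharFun P Y n u
      = (((n : ℝ) ^ ((k : ℝ) / 2) *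
          ((2 * π) ^ k * (prodDist P n).real {x | ∑ i, Y (x i) = 0}) : ℝ) : ℂ) := by
  unfold rescaledCharFun
  rw [Measure.integral_comp_inv_smul_of_nonneg volume _ (sqrt_nonneg _),
    integral_indicator (isCompact_piCube k).measurableSet, setIntegral_vecCharFun_pow Y n hint,
    Module.finrank_fin_fun, Complex.real_smul]
  have : √(n : ℝ) ^ k = (n : ℝ) ^ ((k : ℝ) / 2) := by
    rw [sqrt_eq_rpow, ← rpow_natCast, ← rpow_mul (Nat.cast_nonneg n)]
    congr 1
    ring
  rw [this]
  push_cast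
  rfl

omit [DiscreteMeasurableSpace X] [IsProbabilityMeasure P] in
lemma ae_singleton_ne_zero [MeasurableSingletonClass X] : ∀ᵐ x ∂P, P {x} ≠ 0 := by
  rw [ae_iff_of_countable]
  exact fun x hx => hx

lemma ae_prodDist_singleton_ne_zero (n : ℕ) : ∀ᵐ x ∂(prodDist P n), ∀ i, P {x i} ≠ 0 := by
  unfold prodDist
  exact eventually_all.2 fun i =>
    (Measure.tendsto_eval_ae_ae (μ := fun _ : Fin n => P) (i := i)).eventually
      (p := fun y => P {y} ≠ 0) ae_singleton_ne_zero

/-- **Local limit theorem** for lattice random vectors: `Y` is centered with positive definite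
covariance matrix and its differences generate `ℤ ^ k`. -/
theorem tendsto_prodDist_sum_eq_zero (Y : X → Fin k → ℝ)
    (h2 : ∀ i j, Integrable (fun x => Y x i * Y x j) P)
    (h1 : ∀ i, Integrable (fun x => Y x i) P) (h0 : ∀ i, ∫ x, Y x i ∂P = 0)
    (hV : (covMatrix Y P).PosDef) (hgen : ∀ j, Pi.single j 1 ∈ differenceLattice P Y)
    (hint : ∀ v ∈ differenceLattice P Y, ∀ j, ∃ m : ℤ, v j = m) :
    Tendsto (fun n : ℕ => (n : ℝ) ^ ((k : ℝ) / 2) * (prodDist P n).real {x | ∑ i, Y (x i) = 0})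
      (atTop ⊓ 𝓟 {n | 0 < prodDist P n {x | ∑ i, Y (x i) = 0}})
      (𝓝 (1 / √((2 * π) ^ k * (covMatrix Y P).det))) := by
  have hlim := (Complex.continuous_re.tendsto _).comp
    ((tendsto_integral_rescaledCharFun Y h2 h1 h0 hV hgen).mono_left
      (inf_le_left (b := 𝓟 {n | 0 < prodDist P n {x | ∑ i, Y (x i) = 0}})))
  have hlim' := hlim.const_mul ((2 * π) ^ k)⁻¹
  have hpi : (0 : ℝ) < (2 * π) ^ k := by positivity
  have e : ((2 * π) ^ k)⁻¹ * ((√((2 * π) ^ k) / √(covMatrix Y P).det : ℝ) : ℂ).re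
      = 1 / √((2 * π) ^ k * (covMatrix Y P).det) := by
    rw [Complex.ofReal_re, sqrt_mul hpi.le]
    have hs : √((2 * π) ^ k) ≠ 0 := (sqrt_pos.2 hpi).ne'
    have hs2 : √(covMatrix Y P).det ≠ 0 := (sqrt_pos.2 hV.det_pos).ne'
    have := mul_self_sqrt hpi.le
    field_simp
    rw [sq, this]
  rw [e] at hlim'
  refine hlim'.congr' ?_
  filter_upwards [mem_inf_of_right (mem_principal_self _)] with n hn
  -- In general the sums lie only in a coset of the difference lattice. A reference sample of atoms
  -- with sum zero shows that the coset is the lattice itself, so the sums are integral.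
  obtain ⟨x₀, hx₀, hx₀'⟩ : ∃ x : Fin n → X, ∑ i, Y (x i) = 0 ∧ ∀ i, P {x i} ≠ 0 := by
    have hfr : ∃ᵐ x ∂(prodDist P n), ∑ i, Y (x i) = 0 := by
      rw [frequently_ae_iff]
      exact hn.ne'
    exact (hfr.and_eventually (ae_prodDist_singleton_ne_zero n)).exists
  have hsum : ∀ᵐ x ∂(prodDist P n), ∀ j, ∃ m : ℤ, (∑ i, Y (x i)) j = m := by
    filter_upwards [ae_prodDist_singleton_ne_zero (P := P) n] with x hx
    refine hint _ ?_
    have : ∑ i, Y (x i) = ∑ i, (Y (x i) - Y (x₀ i)) := by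
      rw [Finset.sum_sub_distrib, hx₀, sub_zero]
    rw [this]
    exact sum_mem fun i _ => AddSubgroup.subset_closure ⟨x i, x₀ i, hx i, hx₀' i, rfl⟩
  simp only [Function.comp_apply]
  rw [integral_rescaledCharFun Y n hsum, Complex.ofReal_re]
  field_simp

end LocalLimit

end MaxEnt

namespace MaxEnt

open Real

/-! ### Full-rank sublattices and their covolume -/

section Lattice

variable {k : ℕ}

/-- The basis `h₁ e₁, …, h_k e_k`. -/
noncomputable def scaledBasis (h : Fin k → ℝ) (hpos : ∀ j, 0 < h j) :
    Module.Basis (Fin k) ℝ (Fin k → ℝ) :=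
  (Pi.basisFun ℝ (Fin k)).isUnitSMul fun j => (hpos j).ne'.isUnit

lemma scaledBasis_apply (h : Fin k → ℝ) (hpos : ∀ j, 0 < h j) (j : Fin k) :
    scaledBasis h hpos j = Pi.single j (h j) := by
  rw [scaledBasis, Module.Basis.isUnitSMul_apply, Pi.basisFun_apply, ← Pi.single_smul]
  simp

lemma mem_span_scaledBasis_iff (h : Fin k → ℝ) (hpos : ∀ j, 0 < h j) (v : Fin k → ℝ) :
    v ∈ Submodule.span ℤ (Set.range (scaledBasis h hpos)) ↔ v ∈ productLattice h := by
  rw [Module.Basis.mem_span_iff_repr_mem, productLattice, AddSubgroup.mem_pi]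
  refine forall_congr' fun j => ?_
  have e : (scaledBasis h hpos).repr v j = (h j)⁻¹ * v j := by
    rw [scaledBasis, Module.Basis.repr_isUnitSMul]
    simp [Units.smul_def]
  rw [e, AddSubgroup.mem_zmultiples_iff]
  simp only [Set.mem_range, Set.mem_univ, true_implies, zsmul_eq_mul, eq_intCast]
  refine exists_congr fun m => ?_
  rw [eq_inv_mul_iff_mul_eq₀ (hpos j).ne', mul_comm]

lemma covolume_span_scaledBasis (h : Fin k → ℝ) (hpos : ∀ j, 0 < h j) :
    ZLattice.covolume (Submodule.span ℤ (Set.range (scaledBasis h hpos))) = ∏ j, h j := by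
  rw [ZLattice.covolume_eq_det _ ((scaledBasis h hpos).restrictScalars ℤ)]
  have e : Matrix.of ((↑) ∘ ((scaledBasis h hpos).restrictScalars ℤ)) = Matrix.diagonal h := by
    ext i j
    simp only [Matrix.of_apply, Function.comp_apply, Module.Basis.restrictScalars_apply,
      scaledBasis_apply, Matrix.diagonal_apply, Pi.single_apply]
    simp only [eq_comm]
  rw [e, Matrix.det_diagonal, abs_of_pos (Finset.prod_pos fun j _ => hpos j)]

/-- A full-rank sublattice of `h₁ ℤ × ⋯ × h_k ℤ` is mapped onto `ℤ ^ k` by a matrix whose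
determinant is determined by the index. -/
lemma exists_matrix_of_le_productLattice (h : Fin k → ℝ) (hpos : ∀ j, 0 < h j)
    (Λ : AddSubgroup (Fin k → ℝ)) (hle : Λ ≤ productLattice h)
    (hspan : Submodule.span ℝ (Λ : Set (Fin k → ℝ)) = ⊤) :
    ∃ M : Matrix (Fin k) (Fin k) ℝ, M.det ≠ 0 ∧
      (∀ v, v ∈ Λ ↔ ∀ j, ∃ m : ℤ, (M *ᵥ v) j = m) ∧
      |M.det|⁻¹ = Λ.relIndex (productLattice h) * ∏ j, h j := by
  set L₂ := Submodule.span ℤ (Set.range (scaledBasis h hpos)) with hL₂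
  let L₁ : Submodule ℤ (Fin k → ℝ) := AddSubgroup.toIntSubmodule Λ
  have hL : L₁ ≤ L₂ := fun v hv => (mem_span_scaledBasis_iff h hpos v).2 (hle hv)
  have hd : DiscreteTopology L₁ :=
    DiscreteTopology.of_subset (s := (L₂ : Set (Fin k → ℝ)))
      (inferInstanceAs (DiscreteTopology (Submodule.span ℤ (Set.range (scaledBasis h hpos))))) hL
  have hz : IsZLattice ℝ L₁ := ⟨hspan⟩
  -- The matrix sought is the coordinate map of a `ℤ`-basis of `Λ`.
  let b₁ := IsZLattice.basis L₁
  let b := b₁.ofZLatticeBasis ℝ L₁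
  have hM : ∀ v, LinearMap.toMatrix' (b.equivFun : (Fin k → ℝ) →ₗ[ℝ] (Fin k → ℝ)) *ᵥ v
      = b.equivFun v := by
    intro v
    rw [LinearMap.toMatrix'_mulVec]
    rfl
  refine ⟨LinearMap.toMatrix' (b.equivFun : (Fin k → ℝ) →ₗ[ℝ] (Fin k → ℝ)), ?_, ?_, ?_⟩
  · rw [LinearMap.det_toMatrix']
    exact (LinearEquiv.isUnit_det' _).ne_zero
  · intro v
    have h1 : v ∈ Λ ↔ v ∈ Submodule.span ℤ (Set.range b) := by
      rw [Module.Basis.ofZLatticeBasis_span]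
      rfl
    rw [h1, Module.Basis.mem_span_iff_repr_mem, hM]
    refine forall_congr' fun j => ?_
    simp only [Set.mem_range, eq_intCast, Module.Basis.equivFun_apply]
    exact exists_congr fun m => eq_comm
  -- The index is the ratio of covolumes, and the covolume of `Λ` is `|det M|⁻¹`.
  · have h1 := ZLattice.covolume_div_covolume_eq_relIndex L₁ L₂ hL
    have h2 : L₂.toAddSubgroup = productLattice h := by
      ext v
      exact mem_span_scaledBasis_iff h hpos v
    have h3 : L₁.toAddSubgroup = Λ := rfl
    rw [h2, h3, covolume_span_scaledBasis, ZLattice.covolume_eq_det_inv L₁ b₁,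
      div_eq_iff (Finset.prod_pos fun j _ => hpos j).ne'] at h1
    rw [LinearMap.det_toMatrix', ← h1, LinearEquiv.coe_det]

end Lattice

/-! ### Covariance under affine maps, and nondegeneracy -/

section Covariance

variable {X : Type*} [MeasurableSpace X] {k : ℕ} {P : Measure X}

lemma covMatrix_mulVec (Y : X → Fin k → ℝ)
    (h2 : ∀ i j, Integrable (fun x => Y x i * Y x j) P)
    (h1 : ∀ i, Integrable (fun x => Y x i) P) (h0 : ∀ i, ∫ x, Y x i ∂P = 0)
    (M : Matrix (Fin k) (Fin k) ℝ) :
    (∀ i j, Integrable (fun x => (M *ᵥ Y x) i * (M *ᵥ Y x) j) P) ∧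
    (∀ i, Integrable (fun x => (M *ᵥ Y x) i) P) ∧ (∀ i, ∫ x, (M *ᵥ Y x) i ∂P = 0) ∧
    covMatrix (fun x => M *ᵥ Y x) P = M * covMatrix Y P * Mᵀ := by
  have e : ∀ i j x, (M *ᵥ Y x) i * (M *ᵥ Y x) j = ∑ b, ∑ a, M i a * M j b * (Y x a * Y x b) := by
    intro i j x
    rw [Matrix.mulVec, Matrix.mulVec, dotProduct, dotProduct, Finset.sum_mul_sum, Finset.sum_comm]
    refine Finset.sum_congr rfl fun b _ => Finset.sum_congr rfl fun a _ => ?_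
    ring
  have hmean : ∀ i, ∫ x, (M *ᵥ Y x) i ∂P = 0 := by
    intro i
    have := integral_dotProduct (P := P) Y h1 (M i)
    simp only [h0] at this
    rw [show (fun x => (M *ᵥ Y x) i) = fun x => M i ⬝ᵥ Y x from rfl, this]
    simp [dotProduct]
  refine ⟨fun i j => ?_, fun i => ?_, hmean, ?_⟩
  · simp_rw [e]
    exact integrable_finsetSum _ fun b _ => integrable_finsetSum _ fun a _ => (h2 a b).const_mul _
  · simp only [Matrix.mulVec, dotProduct]
    exact integrable_finsetSum _ fun a _ => (h1 a).const_mul _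
  · ext i j
    rw [covMatrix, Matrix.of_apply, hmean, zero_mul, sub_zero]
    simp_rw [e]
    rw [integral_finsetSum _ fun b _ => integrable_finsetSum _ fun a _ => (h2 a b).const_mul _,
      Matrix.mul_apply]
    refine Finset.sum_congr rfl fun b _ => ?_
    rw [integral_finsetSum _ fun a _ => (h2 a b).const_mul _, Matrix.mul_apply, Finset.sum_mul]
    refine Finset.sum_congr rfl fun a _ => ?_
    rw [integral_const_mul, covMatrix, Matrix.of_apply, h0, zero_mul, sub_zero,
      Matrix.transpose_apply]
    ring

lemma covMatrix_sub_const [IsProbabilityMeasure P] (T : X → Fin k → ℝ) (t : Fin k → ℝ)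
    (h2 : ∀ i j, Integrable (fun x => T x i * T x j) P) (hm : MomentConstraint T t P) :
    (∀ i j, Integrable (fun x => (T x - t) i * (T x - t) j) P) ∧
    (∀ i, Integrable (fun x => (T x - t) i) P) ∧ (∀ i, ∫ x, (T x - t) i ∂P = 0) ∧
    covMatrix (fun x => T x - t) P = covMatrix T P := by
  have e : ∀ i j x, (T x - t) i * (T x - t) j
      = T x i * T x j - (T x i * t j + t i * T x j - t i * t j) := by
    intro i j x
    simp only [Pi.sub_apply]
    ring
  have h1 := fun i => (hm i).1
  have h1' : ∀ i j, Integrable (fun x => T x i * t j + t i * T x j) P :=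
    fun i j => ((h1 i).mul_const _).add ((h1 j).const_mul _)
  have hi : ∀ i j, Integrable (fun x => T x i * t j + t i * T x j - t i * t j) P :=
    fun i j => (h1' i j).sub (integrable_const _)
  have hmean : ∀ i, ∫ x, (T x - t) i ∂P = 0 := by
    intro i
    simp only [Pi.sub_apply]
    rw [integral_sub (h1 i) (integrable_const _), (hm i).2]
    simp
  refine ⟨fun i j => ?_, fun i => (h1 i).sub (integrable_const _), hmean, ?_⟩
  · simp_rw [e]
    exact (h2 i j).sub (hi i j)
  · ext i j
    rw [covMatrix, Matrix.of_apply, hmean, zero_mul, sub_zero, covMatrix, Matrix.of_apply]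
    simp_rw [e]
    rw [integral_sub (h2 i j) (hi i j), integral_sub (h1' i j) (integrable_const _),
      integral_add ((h1 i).mul_const _) ((h1 j).const_mul _), integral_mul_const,
      integral_const_mul, (hm i).2, (hm j).2]
    simp

/-- The quadratic form at `u` is the second moment of `u ⬝ Y`, hence nonnegative; invertibility
makes it definite. -/
lemma posDef_covMatrix (Y : X → Fin k → ℝ)
    (h2 : ∀ i j, Integrable (fun x => Y x i * Y x j) P) (h0 : ∀ i, ∫ x, Y x i ∂P = 0)
    (hu : IsUnit (covMatrix Y P)) : (covMatrix Y P).PosDef := by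
  refine (Matrix.PosSemidef.posDef_iff_isUnit
    (Matrix.PosSemidef.of_dotProduct_mulVec_nonneg ?_ fun u => ?_)).2 hu
  · ext i j
    simp [covMatrix, mul_comm]
  · rw [star_trivial, ← integral_dotProduct_sq Y h2 h0]
    exact integral_nonneg fun x => sq_nonneg _

lemma differenceLattice_mulVec_sub (T : X → Fin k → ℝ) (t : Fin k → ℝ)
    (M : Matrix (Fin k) (Fin k) ℝ) :
    differenceLattice P (fun x => M *ᵥ (T x - t))
      = (differenceLattice P T).map M.mulVecLin.toAddMonoidHom := by
  rw [differenceLattice, differenceLattice, AddMonoidHom.map_closure]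
  congr 1
  ext v
  constructor
  · rintro ⟨x, y, hx, hy, rfl⟩
    refine ⟨_, ⟨x, y, hx, hy, rfl⟩, ?_⟩
    simp [Matrix.mulVec_sub]
  · rintro ⟨_, ⟨x, y, hx, hy, rfl⟩, rfl⟩
    refine ⟨x, y, hx, hy, ?_⟩
    simp [Matrix.mulVec_sub]

/-- If the span were proper, some `u ≠ 0` would annihilate all differences. Then `u ⬝ T` would be
almost surely constant and its variance, the covariance form at `u`, would vanish. -/
lemma span_differenceLattice_eq_top [Countable X] [DiscreteMeasurableSpace X]
    [IsProbabilityMeasure P] (T : X → Fin k → ℝ) (t : Fin k → ℝ)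
    (h2 : ∀ i j, Integrable (fun x => T x i * T x j) P) (hm : MomentConstraint T t P)
    (hV : (covMatrix T P).PosDef) :
    Submodule.span ℝ (differenceLattice P T : Set (Fin k → ℝ)) = ⊤ := by
  by_contra hne
  obtain ⟨f, hf, hker⟩ := Submodule.exists_le_ker_of_lt_top _ (lt_top_iff_ne_top.2 hne)
  obtain ⟨u, rfl⟩ := (dotProductEquiv ℝ (Fin k)).surjective f
  have hu : u ≠ 0 := fun h => hf (by rw [h, map_zero])
  have hconst : ∀ x y, P {x} ≠ 0 → P {y} ≠ 0 → u ⬝ᵥ T x = u ⬝ᵥ T y := by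
    intro x y hx hy
    have hmem : T x - T y ∈ differenceLattice P T :=
      AddSubgroup.subset_closure ⟨x, y, hx, hy, rfl⟩
    have := hker (Submodule.subset_span hmem)
    simp only [LinearMap.mem_ker, dotProductEquiv_apply_apply, dotProduct_sub] at this
    linarith
  obtain ⟨y, hy⟩ := (ae_singleton_ne_zero (P := P)).exists
  have hae : ∀ᵐ x ∂P, u ⬝ᵥ T x = u ⬝ᵥ T y := by
    filter_upwards [ae_singleton_ne_zero (P := P)] with x hx
    exact hconst x y hx hy
  have hmean : u ⬝ᵥ t = u ⬝ᵥ T y := by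
    have h1 := integral_dotProduct T (fun i => (hm i).1) u
    rw [integral_congr_ae hae] at h1
    simp only [fun i => (hm i).2] at h1
    simpa using h1.symm
  obtain ⟨g2, -, g0, gc⟩ := covMatrix_sub_const T t h2 hm
  have hz := integral_dotProduct_sq _ g2 g0 u
  rw [gc, integral_eq_zero_of_ae] at hz
  · have := hV.dotProduct_mulVec_pos hu
    rw [star_trivial, ← hz] at this
    exact lt_irrefl _ this
  · filter_upwards [hae] with x hx
    simp [dotProduct_sub, hx, hmean]

end Covariance

/-! ### Elementary properties of the span -/

section Span

variable {X : Type*} [MeasurableSpace X] {k : ℕ} {Q : Measure X} {T : X → Fin k → ℝ}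
  {h : Fin k → ℝ}

/-- If `r` is a step, so is `-r`, and maximality gives `h j ≥ 0`. If `h j = 0`, the coordinate is
constant on atoms and `1` is also a step, contradicting maximality. -/
lemma IsSpan.pos (hT : IsSpan Q T h) (j : Fin k) : 0 < h j := by
  obtain ⟨⟨b, hb⟩, hmax⟩ := hT j
  have hnn : -h j ≤ h j := by
    refine hmax ⟨b, fun x hx => ?_⟩
    obtain ⟨s, hs⟩ := hb x hx
    exact ⟨-s, by rw [hs]; push_cast; ring⟩
  rcases (neg_le_self_iff.1 hnn).eq_or_lt with h0 | h0
  · have : (1 : ℝ) ≤ h j := by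
      refine hmax ⟨b, fun x hx => ?_⟩
      obtain ⟨s, hs⟩ := hb x hx
      exact ⟨0, by rw [hs, ← h0]; simp⟩
    linarith
  · exact h0

lemma IsSpan.differenceLattice_le (hT : IsSpan Q T h) :
    differenceLattice Q T ≤ productLattice h := by
  rw [differenceLattice, AddSubgroup.closure_le]
  rintro _ ⟨x, y, hx, hy, rfl⟩ j -
  obtain ⟨b, hb⟩ := (hT j).1
  obtain ⟨s, hs⟩ := hb x hx
  obtain ⟨r, hr⟩ := hb y hy
  refine AddSubgroup.mem_zmultiples_iff.2 ⟨s - r, ?_⟩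
  rw [Pi.sub_apply, hs, hr, zsmul_eq_mul]
  push_cast
  ring

end Span

end MaxEnt

namespace MaxEnt

open Real

/-! ### The maximum entropy property -/

section MaximumEntropy

variable {X : Type*} [MeasurableSpace X] {k : ℕ} {Q : Measure X} [IsProbabilityMeasure Q]
  {T : X → Fin k → ℝ} {t β : Fin k → ℝ}

lemma Condition1.isProbabilityMeasure (hC : Condition1 Q T t β) :
    IsProbabilityMeasure (expDist Q T β) :=
  isProbabilityMeasure_tilted hC.1

lemma MomentConstraint.integral_neg_dotProduct {P : Measure X} (hm : MomentConstraint T t P)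
    (β : Fin k → ℝ) :
    Integrable (fun x => -(β ⬝ᵥ T x)) P ∧ ∫ x, -(β ⬝ᵥ T x) ∂P = -(β ⬝ᵥ t) := by
  constructor
  · simp only [dotProduct]
    exact (integrable_finsetSum _ fun i _ => (hm i).1.const_mul _).neg
  · rw [integral_neg, integral_dotProduct T (fun i => (hm i).1)]
    simp only [fun i => (hm i).2]

/-- The exponential distribution is the unique minimizer of the relative entropy. -/
theorem Condition1.isMaxEnt (hC : Condition1 Q T t β) : IsMaxEnt Q T t (expDist Q T β) := by
  have hP := hC.isProbabilityMeasure
  refine ⟨⟨hP, hC.2⟩, fun P' hP' hm' hne => ?_⟩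
  obtain ⟨hexp, hm⟩ := hC
  set P := expDist Q T β with hPdef
  set Z := ∫ x, exp (-(β ⬝ᵥ T x)) ∂Q
  have hPQ : P ≪ Q := tilted_absolutelyContinuous _ _
  have hQP : Q ≪ P := absolutelyContinuous_tilted hexp
  obtain ⟨hfP, hfP'⟩ := hm.integral_neg_dotProduct β
  -- Applying the tilting formula to `llr P P = 0` and solving for `llr P Q` gives the affine
  -- log-density.
  have hllr : llr P Q =ᵐ[P] fun x => -(β ⬝ᵥ T x) - log Z := by
    filter_upwards [llr_tilted_right hPQ hexp, llr_self P] with x hx hx'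
    change llr P P x = _ at hx
    rw [hx', Pi.zero_apply] at hx
    change 0 = -(-(β ⬝ᵥ T x)) + log Z + llr P Q x at hx
    linarith
  have hint : Integrable (llr P Q) P :=
    (integrable_congr hllr).2 (hfP.sub (integrable_const _))
  have hval : ∫ x, llr P Q x ∂P = -(β ⬝ᵥ t) - log Z := by
    rw [integral_congr_ae hllr, integral_sub hfP (integrable_const _), hfP']
    simp
  by_cases htop : InformationTheory.klDiv P' Q = ⊤
  · rw [htop]
    exact (InformationTheory.klDiv_ne_top hPQ hint).lt_top
  obtain ⟨hac, hint'⟩ := InformationTheory.klDiv_ne_top_iff.1 htop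
  obtain ⟨hfP1, hfP1'⟩ := hm'.integral_neg_dotProduct β
  have hac' : P' ≪ P := hac.trans hQP
  have hint2 : Integrable (llr P' P) P' := integrable_llr_tilted_right hac hfP1 hint' hexp
  have hval' : ∫ x, llr P' P x ∂P' = ∫ x, llr P' Q x ∂P' - -(β ⬝ᵥ t) + log Z := by
    rw [← hfP1']
    exact integral_llr_tilted_right hac hfP1 hexp hint'
  -- Strictness and uniqueness come from here: `D(P'‖P)` vanishes only when `P' = P`.
  have hpos : 0 < ∫ x, llr P' P x ∂P' := by
    rw [← InformationTheory.toReal_klDiv_of_measure_eq hac' (by simp)]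
    exact ENNReal.toReal_pos (fun h => hne (InformationTheory.klDiv_eq_zero_iff.1 h))
      (InformationTheory.klDiv_ne_top hac' hint2)
  have hnn := InformationTheory.integral_llr_add_sub_measure_univ_nonneg hPQ hint
  rw [InformationTheory.klDiv_of_ac_of_integrable hPQ hint,
    InformationTheory.klDiv_of_ac_of_integrable hac hint']
  simp only [probReal_univ, add_sub_cancel_right] at hnn ⊢
  rw [ENNReal.ofReal_lt_ofReal_iff_of_nonneg hnn]
  linarith

end MaximumEntropy

/-! ### Conditioning on the constraint and its asymptotic probability -/

section Conditioning

variable {X : Type*} [Countable X] [MeasurableSpace X] [DiscreteMeasurableSpace X] {k : ℕ}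
  {Q : Measure X} [IsProbabilityMeasure Q] {T : X → Fin k → ℝ} {t β : Fin k → ℝ}

omit [Countable X] in
lemma expDist_singleton (x : X) :
    expDist Q T β {x}
      = ENNReal.ofReal (exp (-(β ⬝ᵥ T x)) / ∫ y, exp (-(β ⬝ᵥ T y)) ∂Q) * Q {x} := by
  rw [expDist, tilted_apply, lintegral_singleton]

omit [Countable X] [DiscreteMeasurableSpace X] in
lemma prodDist_singleton (P : Measure X) [IsProbabilityMeasure P] {n : ℕ} (x : Fin n → X) :
    prodDist P n {x} = ∏ i, P {x i} := by
  rw [prodDist, Measure.pi_singleton]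

instance isProbabilityMeasure_prodDist (P : Measure X) [IsProbabilityMeasure P] (n : ℕ) :
    IsProbabilityMeasure (prodDist P n) := by
  unfold prodDist
  infer_instance

omit [Countable X] [MeasurableSpace X] [DiscreteMeasurableSpace X] in
lemma sum_eq_of_mem_constraintSet {n : ℕ} {x : Fin n → X} (hx : x ∈ constraintSet T t n)
    (hn : 0 < n) : ∑ i, T (x i) = (n : ℝ) • t := by
  have hn' : (n : ℝ) ≠ 0 := by positivity
  rw [← (show (n : ℝ)⁻¹ • ∑ i, T (x i) = t from hx), smul_smul, mul_inv_cancel₀ hn', one_smul]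

/-- On the constraint set the exponential product distribution has constant density. -/
lemma exists_prodDist_inter_constraintSet_eq (hC : Condition1 Q T t β) {n : ℕ} (hn : 0 < n) :
    ∃ K : ENNReal, K ≠ 0 ∧ K ≠ ⊤ ∧ ∀ A : Set (Fin n → X),
      prodDist (expDist Q T β) n (constraintSet T t n ∩ A)
        = K * prodDist Q n (constraintSet T t n ∩ A) := by
  have hP := hC.isProbabilityMeasure
  set Z := ∫ y, exp (-(β ⬝ᵥ T y)) ∂Q
  have hZ : 0 < Z := integral_exp_pos hC.1
  refine ⟨ENNReal.ofReal (exp (-(β ⬝ᵥ ((n : ℝ) • t))) / Z ^ n),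
    (ENNReal.ofReal_pos.2 (by positivity)).ne', ENNReal.ofReal_ne_top, fun A => ?_⟩
  have h : (prodDist (expDist Q T β) n).restrict (constraintSet T t n)
      = ENNReal.ofReal (exp (-(β ⬝ᵥ ((n : ℝ) • t))) / Z ^ n) •
        (prodDist Q n).restrict (constraintSet T t n) := by
    -- `X ^ n` is countable, so it suffices to compare atoms; the density at a sample depends only
    -- on its sum of `T`, which is `n t` here.
    refine Measure.ext_of_singleton fun x => ?_
    rw [Measure.smul_apply, Measure.restrict_apply (MeasurableSet.of_discrete),
      Measure.restrict_apply (MeasurableSet.of_discrete), smul_eq_mul]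
    by_cases hx : x ∈ constraintSet T t n
    · rw [Set.inter_eq_left.2 (Set.singleton_subset_iff.2 hx), prodDist_singleton,
        prodDist_singleton]
      simp_rw [expDist_singleton]
      rw [Finset.prod_mul_distrib, ← ENNReal.ofReal_prod_of_nonneg fun i _ => by positivity,
        Finset.prod_div_distrib, ← exp_sum, Finset.prod_const, Finset.card_fin,
        Finset.sum_neg_distrib, ← dotProduct_sum, sum_eq_of_mem_constraintSet hx hn]
    · rw [Set.singleton_inter_eq_empty.2 hx]
      simp
  have := congrArg (fun μ => μ A) h
  simp only [Measure.smul_apply, smul_eq_mul] at this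
  rwa [Measure.restrict_apply (MeasurableSet.of_discrete),
    Measure.restrict_apply (MeasurableSet.of_discrete), Set.inter_comm] at this

/-- The constant density cancels on conditioning, so the conditional law under `Q` is also that of
the tilted measure. -/
lemma prodDist_expDist_inter_constraintSet (hC : Condition1 Q T t β) {n : ℕ}
    (hn : n ∈ feasible Q T t) (A : Set (Fin n → X)) :
    (prodDist (expDist Q T β) n).real (constraintSet T t n ∩ A)
      = (prodDist (expDist Q T β) n).real (constraintSet T t n) * condProb Q T t n A := by
  obtain ⟨K, hK0, hKt, hK⟩ := exists_prodDist_inter_constraintSet_eq hC hn.1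
  have hC' := hK Set.univ
  rw [Set.inter_univ] at hC'
  simp only [measureReal_def, condProb]
  rw [ProbabilityTheory.cond_apply (MeasurableSet.of_discrete), hC', hK, ← ENNReal.toReal_mul]
  congr 1
  rw [mul_assoc, ← mul_assoc (prodDist Q n _), ENNReal.mul_inv_cancel hn.2.ne' (measure_ne_top _ _),
    one_mul]

lemma prodDist_expDist_constraintSet_pos (hC : Condition1 Q T t β) {n : ℕ}
    (hn : n ∈ feasible Q T t) : 0 < prodDist (expDist Q T β) n (constraintSet T t n) := by
  obtain ⟨K, hK0, hKt, hK⟩ := exists_prodDist_inter_constraintSet_eq hC hn.1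
  have hC' := hK Set.univ
  rw [Set.inter_univ] at hC'
  rw [hC']
  exact ENNReal.mul_pos hK0 hn.2.ne'

omit [Countable X] in
lemma differenceLattice_expDist (hC : Condition1 Q T t β) :
    differenceLattice (expDist Q T β) T = differenceLattice Q T := by
  have hZ : 0 < ∫ y, exp (-(β ⬝ᵥ T y)) ∂Q := integral_exp_pos hC.1
  have h : ∀ x, expDist Q T β {x} ≠ 0 ↔ Q {x} ≠ 0 := by
    intro x
    rw [expDist_singleton, mul_ne_zero_iff, and_iff_right]
    exact (ENNReal.ofReal_pos.2 (by positivity)).ne'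
  simp only [differenceLattice, h]

/-- Local limit theorem for the probability of the constraint set. -/
lemma IsSpan.limit_pos_and_tendsto {h : Fin k → ℝ} (hT : IsSpan Q T h)
    (hC1 : Condition1 Q T t β) (hC2 : Condition2 T (expDist Q T β)) :
    0 < ((latticeIndex Q T h : ℝ) * ∏ j, h j) /
          √((2 * π) ^ k * (covMatrix T (expDist Q T β)).det) ∧
    Tendsto (fun n : ℕ => (n : ℝ) ^ ((k : ℝ) / 2) *
        (prodDist (expDist Q T β) n).real (constraintSet T t n))
      (atTop ⊓ 𝓟 (feasible Q T t))
      (𝓝 (((latticeIndex Q T h : ℝ) * ∏ j, h j) /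
          √((2 * π) ^ k * (covMatrix T (expDist Q T β)).det))) := by
  have hP := hC1.isProbabilityMeasure
  have hdl := differenceLattice_expDist hC1
  set P := expDist Q T β
  obtain ⟨z2, z1, z0, zc⟩ := covMatrix_sub_const T t hC2.1 hC1.2
  have hS : (covMatrix T P).PosDef := by
    rw [← zc]
    exact posDef_covMatrix _ z2 z0 (by rw [zc]; exact hC2.2)
  have hspan := span_differenceLattice_eq_top T t hC2.1 hC1.2 hS
  rw [hdl] at hspan
  obtain ⟨M, hM0, hMint, hMdet⟩ := exists_matrix_of_le_productLattice h hT.pos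
    (differenceLattice Q T) hT.differenceLattice_le hspan
  obtain ⟨y2, y1, y0, yc⟩ := covMatrix_mulVec (fun x => T x - t) z2 z1 z0 M
  have hMu : IsUnit M := (Matrix.isUnit_iff_isUnit_det M).2 hM0.isUnit
  have hcov := yc
  rw [zc] at hcov
  have hV : (covMatrix (fun x => M *ᵥ (T x - t)) P).PosDef := by
    refine posDef_covMatrix _ y2 y0 ?_
    rw [hcov]
    exact (hMu.mul hS.isUnit).mul ((Matrix.isUnit_transpose M).2 hMu)
  have hmap := differenceLattice_mulVec_sub (P := P) T t M
  rw [hdl] at hmap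
  have hgen : ∀ j, Pi.single j 1 ∈ differenceLattice P fun x => M *ᵥ (T x - t) := by
    intro j
    have e : M *ᵥ (M⁻¹ *ᵥ Pi.single j 1) = Pi.single j 1 := by
      rw [Matrix.mulVec_mulVec, Matrix.mul_nonsing_inv _ hM0.isUnit, Matrix.one_mulVec]
    rw [hmap]
    -- `M⁻¹ e_j` lies in the difference lattice because its image `e_j` is integral.
    refine ⟨M⁻¹ *ᵥ Pi.single j 1, (hMint _).2 fun i => ?_, e⟩
    rw [e, Pi.single_apply]
    split_ifs
    · exact ⟨1, by simp⟩
    · exact ⟨0, by simp⟩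
  have hint : ∀ v ∈ differenceLattice P fun x => M *ᵥ (T x - t), ∀ j, ∃ m : ℤ, v j = m := by
    rw [hmap]
    rintro _ ⟨v, hv, rfl⟩
    exact (hMint v).1 hv
  have hlim := tendsto_prodDist_sum_eq_zero _ y2 y1 y0 hV hgen hint
  -- Positivity of `n` is needed: for `n = 0` the empty sum always vanishes, while the average
  -- equals `t` only if `t = 0`.
  have hset : ∀ n : ℕ, 0 < n →
      {x : Fin n → X | ∑ i, M *ᵥ (T (x i) - t) = 0} = constraintSet T t n := by
    intro n hn
    have hn' : (n : ℝ) ≠ 0 := by positivity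
    ext x
    rw [Set.mem_ofPred_eq, constraintSet, Set.mem_ofPred_eq, ← Matrix.mulVec_sum,
      inv_smul_eq_iff₀ hn']
    constructor
    · intro hx
      have := Matrix.eq_zero_of_mulVec_eq_zero hM0 hx
      rw [Finset.sum_sub_distrib, Finset.sum_const, Finset.card_fin, sub_eq_zero] at this
      rw [this, Nat.cast_smul_eq_nsmul]
    · intro hx
      rw [Finset.sum_sub_distrib, Finset.sum_const, Finset.card_fin, hx, Nat.cast_smul_eq_nsmul,
        sub_self, Matrix.mulVec_zero]
  have hpi : (0 : ℝ) < (2 * π) ^ k := by positivity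
  -- The determinant gains the factor `(det M)²`; its square root turns into the covolume `m ∏ h_j`
  -- of the difference lattice.
  have hconst : 1 / √((2 * π) ^ k * (covMatrix (fun x => M *ᵥ (T x - t)) P).det)
      = ((latticeIndex Q T h : ℝ) * ∏ j, h j) / √((2 * π) ^ k * (covMatrix T P).det) := by
    rw [latticeIndex, ← hMdet, hcov, Matrix.det_mul, Matrix.det_mul, Matrix.det_transpose,
      show (2 * π) ^ k * (M.det * (covMatrix T P).det * M.det)
        = M.det ^ 2 * ((2 * π) ^ k * (covMatrix T P).det) by ring,
      sqrt_mul (sq_nonneg _), sqrt_sq_eq_abs, one_div, mul_inv, div_eq_mul_inv]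
  have hpos : 0 < 1 / √((2 * π) ^ k * (covMatrix (fun x => M *ᵥ (T x - t)) P).det) := by
    have := hV.det_pos
    positivity
  rw [← hconst]
  refine ⟨hpos, (hlim.mono_left (inf_le_inf_left _ (principal_mono.2 fun n hn => ?_))).congr' ?_⟩
  · rw [Set.mem_ofPred_eq, hset n hn.1]
    exact prodDist_expDist_constraintSet_pos hC1 hn
  · filter_upwards [mem_inf_of_right (mem_principal_self _)] with n hn
    rw [hset n hn.1]

end Conditioning

end MaxEnt

namespace MaxEnt

/-! ### Transfer of typical sets -/

section Consequence

variable {X : Type*} [Countable X] [MeasurableSpace X] [DiscreteMeasurableSpace X] {k : ℕ}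
  {Q : Measure X} [IsProbabilityMeasure Q] {T : X → Fin k → ℝ} {t : Fin k → ℝ}

lemma one_sub_condProb {n : ℕ} (hn : n ∈ feasible Q T t) (B : Set (Fin n → X)) :
    1 - condProb Q T t n B = condProb Q T t n Bᶜ := by
  have := ProbabilityTheory.cond_isProbabilityMeasure (μ := prodDist Q n) hn.2.ne'
  rw [condProb, condProb, probReal_compl_eq_one_sub (MeasurableSet.of_discrete)]

/-- The lower bound is applied to the complement of `B n`; the factor `n ^ (-k/2)` then cancels on
both sides. -/
lemma isBigO_one_sub_condProb (P : Measure X) [IsProbabilityMeasure P] {c : ℕ → ℝ} {L : ℝ}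
    (hL : 0 < L) (hc : Tendsto c atTop (𝓝 L))
    (hA : ∀ n ∈ feasible Q T t, ∀ A : Set (Fin n → X),
      (n : ℝ) ^ (-(k : ℝ) / 2) * c n * condProb Q T t n A ≤ (prodDist P n).real A)
    (B : (n : ℕ) → Set (Fin n → X)) (f : ℕ → ℝ)
    (hB : (fun n => 1 - (prodDist P n).real (B n))
      =O[atTop ⊓ 𝓟 (feasible Q T t)] fun n => f n * (n : ℝ) ^ (-(k : ℝ) / 2)) :
    (fun n => 1 - condProb Q T t n (B n)) =O[atTop ⊓ 𝓟 (feasible Q T t)] f := by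
  obtain ⟨C, hC⟩ := hB.bound
  -- Eventually `c n > L / 2`, so division by `c n` costs at most `2 / L`.
  refine IsBigO.of_bound (2 / L * C) ?_
  filter_upwards [hC, mem_inf_of_right (mem_principal_self _),
    mem_inf_of_left (hc.eventually (lt_mem_nhds (half_lt_self hL)))] with n hn hf hcn
  have hnpos : (0 : ℝ) < n := Nat.cast_pos.2 hf.1
  have hpow : 0 < (n : ℝ) ^ (-(k : ℝ) / 2) := Real.rpow_pos_of_pos hnpos _
  have h1 := hA n hf (B n)ᶜ
  rw [probReal_compl_eq_one_sub (MeasurableSet.of_discrete)] at h1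
  rw [one_sub_condProb hf]
  have hq : 0 ≤ condProb Q T t n (B n)ᶜ := measureReal_nonneg
  rw [norm_mul, Real.norm_of_nonneg hpow.le] at hn
  rw [Real.norm_of_nonneg hq]
  have h2 : (n : ℝ) ^ (-(k : ℝ) / 2) * (L / 2 * condProb Q T t n (B n)ᶜ)
      ≤ (n : ℝ) ^ (-(k : ℝ) / 2) * (C * ‖f n‖) := by
    calc _ ≤ (n : ℝ) ^ (-(k : ℝ) / 2) * (c n * condProb Q T t n (B n)ᶜ) := by gcongr
      _ = (n : ℝ) ^ (-(k : ℝ) / 2) * c n * condProb Q T t n (B n)ᶜ := by ring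
      _ ≤ _ := h1
      _ ≤ _ := Real.le_norm_self _
      _ ≤ _ := hn
      _ = _ := by ring
  have h3 := le_of_mul_le_mul_left h2 hpow
  calc condProb Q T t n (B n)ᶜ = 2 / L * (L / 2 * condProb Q T t n (B n)ᶜ) := by field_simp
    _ ≤ 2 / L * (C * ‖f n‖) := by gcongr
    _ = _ := by ring

end Consequence

end MaxEnt

/-! ### The main theorem -/

theorem theorem1 {X : Type*} [Countable X] [MeasurableSpace X] [DiscreteMeasurableSpace X]
    (Q : Measure X) [IsProbabilityMeasure Q] {k : ℕ} (hk : 0 < k)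
    (T : X → Fin k → ℝ) (h : Fin k → ℝ) (hT : MaxEnt.IsSpan Q T h)
    (t β : Fin k → ℝ) (hC1 : MaxEnt.Condition1 Q T t β)
    (hC2 : MaxEnt.Condition2 T (MaxEnt.expDist Q T β)) :
    MaxEnt.IsMaxEnt Q T t (MaxEnt.expDist Q T β) ∧
    ∃ c : ℕ → ℝ,
      Tendsto c atTop
        (𝓝 (((MaxEnt.latticeIndex Q T h : ℝ) * ∏ j, h j) /
          √((2 * Real.pi) ^ k * (MaxEnt.covMatrix T (MaxEnt.expDist Q T β)).det))) ∧
      -- item 1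
      (∀ A : (n : ℕ) → Set (Fin n → X), ∀ n ∈ MaxEnt.feasible Q T t,
        (MaxEnt.prodDist (MaxEnt.expDist Q T β) n).real (A n) ≥
          (n : ℝ) ^ (-(k : ℝ) / 2) * c n * MaxEnt.condProb Q T t n (A n)) ∧
      -- consequence for typical sets
      (∀ (B : (n : ℕ) → Set (Fin n → X)) (f : ℕ → ℝ),
        (f =o[atTop ⊓ 𝓟 (MaxEnt.feasible Q T t)] fun _ => (1 : ℝ)) →
        ((fun n => 1 - (MaxEnt.prodDist (MaxEnt.expDist Q T β) n).real (B n))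
          =O[atTop ⊓ 𝓟 (MaxEnt.feasible Q T t)] fun n => f n * (n : ℝ) ^ (-(k : ℝ) / 2)) →
        ((fun n => 1 - MaxEnt.condProb Q T t n (B n))
          =O[atTop ⊓ 𝓟 (MaxEnt.feasible Q T t)] f) ∧
        Tendsto (fun n => MaxEnt.condProb Q T t n (B n))
          (atTop ⊓ 𝓟 (MaxEnt.feasible Q T t)) (𝓝 1)) ∧
      -- item 2
      (∀ A : (n : ℕ) → Set (Fin n → X), (∀ n, 0 < n → A n ⊆ MaxEnt.constraintSet T t n) →
        ∀ n ∈ MaxEnt.feasible Q T t,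
          (MaxEnt.prodDist (MaxEnt.expDist Q T β) n).real (A n) =
            (n : ℝ) ^ (-(k : ℝ) / 2) * c n * MaxEnt.condProb Q T t n (A n)) := by
  classical
  have hP := hC1.isProbabilityMeasure
  obtain ⟨hpos, hlim⟩ := hT.limit_pos_and_tendsto hC1 hC2
  set L := ((MaxEnt.latticeIndex Q T h : ℝ) * ∏ j, h j) /
    √((2 * Real.pi) ^ k * (MaxEnt.covMatrix T (MaxEnt.expDist Q T β)).det)
  refine ⟨hC1.isMaxEnt, ?_⟩
  -- On feasible `n` the value is forced by equality for the constraint set itself. The value `L`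
  -- elsewhere makes the whole sequence converge.
  let c : ℕ → ℝ := fun n => if n ∈ MaxEnt.feasible Q T t then (n : ℝ) ^ ((k : ℝ) / 2) *
    (MaxEnt.prodDist (MaxEnt.expDist Q T β) n).real (MaxEnt.constraintSet T t n) else L
  have hc : Tendsto c atTop (𝓝 L) := by
    exact Tendsto.if hlim tendsto_const_nhds
  have hcn : ∀ n ∈ MaxEnt.feasible Q T t, (n : ℝ) ^ (-(k : ℝ) / 2) * c n
      = (MaxEnt.prodDist (MaxEnt.expDist Q T β) n).real (MaxEnt.constraintSet T t n) := by
    intro n hn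
    have hn0 : (0 : ℝ) < n := Nat.cast_pos.2 hn.1
    simp only [c, if_pos hn]
    rw [← mul_assoc, ← Real.rpow_add hn0, neg_div, neg_add_cancel, Real.rpow_zero, one_mul]
  have hge : ∀ n ∈ MaxEnt.feasible Q T t, ∀ A : Set (Fin n → X),
      (n : ℝ) ^ (-(k : ℝ) / 2) * c n * MaxEnt.condProb Q T t n A
        ≤ (MaxEnt.prodDist (MaxEnt.expDist Q T β) n).real A := by
    intro n hn A
    rw [hcn n hn, ← MaxEnt.prodDist_expDist_inter_constraintSet hC1 hn]
    exact measureReal_mono Set.inter_subset_right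
  refine ⟨c, hc, fun A n hn => hge n hn (A n), fun B f hf hB => ?_, fun A hA n hn => ?_⟩
  · have hO := MaxEnt.isBigO_one_sub_condProb _ hpos hc hge B f hB
    refine ⟨hO, ?_⟩
    have h0 := ((hO.trans_isLittleO hf).tendsto_div_nhds_zero).const_sub 1
    simpa using h0
  · rw [hcn n hn, ← MaxEnt.prodDist_expDist_inter_constraintSet hC1 hn,
      Set.inter_eq_right.2 (hA n hn.1)]
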